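/- Let $(\mathcal A,\varphi)$ be a $C^*$-algebraic probability space: $\mathcal A$ is a unital $C^*$-algebra and $\varphi:\mathcal A\to\mathbb C$ is a linear functional with $\varphi(a^*a)\ge 0$ for all $a\in\mathcal A$ and $\varphi(1)=1$. Let $X^{(1)},X^{(2)},\dots\in\mathcal A$ be self-adjoint elements such that (i) they are identically distributed: $\varphi((X^{(i)})^n)=\varphi((X^{(j)})^n)$ for all $i,j\ge1$, $n\ge0$; (ii) they are monotone independent: with $\mathcal A_i$ the (not necessarily unital) $*$-algebra generated by $X^{(i)}$, one has $$\varphi(a_1\cdots a_n)=\varphi(a_k)\,\varphi(a_1\cdots a_{k-1}a_{k+1}\cdots a_n)$$ whenever $a_j\in\mathcal A_{\lambda_j}$, $a_j\notin\mathbb C1$ for $1\le j\le n$, $\lambda_j\ne\lambda_{j+1}$ for $1\le j\le n-1$, and $\lambda_{k-1}<\lambda_k>\lambda_{k+1}$ (the first inequality is dropped if $k=1$, the second if $k=n$); (iii) $\varphi(X^{(1)})=0$ and $\varphi((X^{(1)})^2)=1$. Put $X_N:=\frac{X^{(1)}+\cdots+X^{(N)}}{\sqrt N}$. The distribution of $X_N$,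 that is, the compactly supported probability measure $\mu_N$ on $\mathbb R$ with $\int x^n\,d\mu_N(x)=\varphi(X_N^n)$ for all $n\ge0$, exists and is unique, and as $N\to\infty$ the measures $\mu_N$ converge weakly to the arcsine law with mean $0$ and variance $1$, the probability measure $\frac{1}{\pi\sqrt{2-x^2}}\mathbf 1_{(-\sqrt2,\sqrt2)}(x)\,dx$. All moments of this law are finite; they are $$M_{2n}=\int_{-\sqrt2}^{\sqrt2}\frac{x^{2n}}{\pi\sqrt{2-x^2}}\,dx=\frac{(2n-1)!!}{n!},\qquad M_{2n+1}=0\qquad(n\ge0),$$ where $(2n-1)!!=1\cdot3\cdots(2n-1)$ and $(-1)!!=1$. -/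

import Mathlib

open MeasureTheory Filter Topology
open scoped ComplexOrder

namespace MonotoneCLT

/-- A state on a unital star-algebra: a linear functional with `φ (a* a) ≥ 0` (in particular real)
and `φ 1 = 1`. -/
structure IsState {A : Type*} [Ring A] [StarRing A] [Algebra ℂ A] (φ : A →ₗ[ℂ] ℂ) : Prop where
  nonneg : ∀ a : A, 0 ≤ φ (star a * a)
  map_one : φ 1 = 1

/-- Monotone independence of a family of (not necessarily unital) star-subalgebras indexed by a
linear order. A word `a₁ ⋯ aₙ` with `aₖ ∈ 𝒜 (lₖ)` is a list of pairs `(lₖ, aₖ)`; its letters are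
not scalar multiples of `1` and consecutive indices differ. Such a word is split as
`u ++ p :: v`, where `p` is the letter `aᵢ` whose index is greater than that of its left neighbour
(the last letter of `u`, if any) and that of its right neighbour (the first letter of `v`, if any).
-/
def MonotoneIndependentSubalgebras {A Λ : Type*} [Ring A] [StarRing A] [Algebra ℂ A]
    [LinearOrder Λ] (φ : A →ₗ[ℂ] ℂ) (𝒜 : Λ → NonUnitalStarSubalgebra ℂ A) : Prop :=
  ∀ (u v : List (Λ × A)) (p : Λ × A),
    (∀ q ∈ u ++ p :: v, q.2 ∈ 𝒜 q.1 ∧ ∀ c : ℂ, q.2 ≠ algebraMap ℂ A c) →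
    List.IsChain (fun q r => q.1 ≠ r.1) (u ++ p :: v) →
    (∀ q ∈ u.getLast?, q.1 < p.1) →
    (∀ q ∈ v.head?, q.1 < p.1) →
    φ ((u ++ p :: v).map Prod.snd).prod = φ p.2 * φ ((u ++ v).map Prod.snd).prod

/-- Elements are monotone independent if the (non-unital) star-subalgebras that they generate
are. -/
def MonotoneIndependent {A Λ : Type*} [Ring A] [StarRing A] [Algebra ℂ A] [StarModule ℂ A]
    [LinearOrder Λ] (φ : A →ₗ[ℂ] ℂ) (x : Λ → A) : Prop :=
  MonotoneIndependentSubalgebras φ fun l => NonUnitalStarAlgebra.adjoin ℂ {x l}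

/-- Identical distribution in the sense of moments. -/
def IdenticallyDistributed {A Λ : Type*} [Ring A] [Algebra ℂ A]
    (φ : A →ₗ[ℂ] ℂ) (x : Λ → A) : Prop :=
  ∀ (i j : Λ) (n : ℕ), φ (x i ^ n) = φ (x j ^ n)

/-- `μ` is the probability distribution of the self-adjoint element `a` with respect to `φ`:
the compactly supported probability measure on `ℝ` whose moments are those of `a`. -/
def IsDistribution {A : Type*} [Ring A] [Algebra ℂ A] (φ : A →ₗ[ℂ] ℂ) (a : A)
    (μ : ProbabilityMeasure ℝ) : Prop :=
  (∃ K : Set ℝ, IsCompact K ∧ (μ : Measure ℝ) Kᶜ = 0) ∧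
    ∀ n : ℕ, φ (a ^ n) = ((∫ x, x ^ n ∂(μ : Measure ℝ) : ℝ) : ℂ)

/-- `(x₀ + ⋯ + x_{N-1}) / √N`. -/
noncomputable def normalizedSum {A : Type*} [Ring A] [Algebra ℂ A] (x : ℕ → A) (N : ℕ) : A :=
  ((√(N : ℝ) : ℝ) : ℂ)⁻¹ • ∑ i ∈ Finset.range N, x i

/-- The measure with density `1 / (π √(2 - x²))` on `(-√2, √2)`. -/
noncomputable def arcsineMeasure : Measure ℝ :=
  (volume.restrict (Set.Ioo (-√2) √2)).withDensity
    fun x => ENNReal.ofReal (1 / (Real.pi * √(2 - x ^ 2)))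

theorem isProbabilityMeasure_arcsineMeasure : IsProbabilityMeasure arcsineMeasure := by
  have h2 : (0 : ℝ) < √2 := by positivity
  have hsq : √2 ^ 2 = (2 : ℝ) := Real.sq_sqrt (by norm_num)
  have hle : -√2 ≤ √2 := by linarith
  have hcont : ContinuousOn (fun x : ℝ => Real.arcsin (x / √2) / Real.pi)
      (Set.Icc (-√2) √2) := by
    have := Real.continuous_arcsin
    fun_prop
  have hderiv : ∀ x ∈ Set.Ioo (-√2) √2, HasDerivAt (fun x : ℝ => Real.arcsin (x / √2) / Real.pi)
      (1 / (Real.pi * √(2 - x ^ 2))) x := by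
    intro x hx
    have h1 : x / √2 ≠ -1 := by
      intro h
      rw [div_eq_iff h2.ne'] at h
      linarith [hx.1]
    have h3 : x / √2 ≠ 1 := by
      intro h
      rw [div_eq_iff h2.ne'] at h
      linarith [hx.2]
    have h := ((Real.hasDerivAt_arcsin h1 h3).comp x
      ((hasDerivAt_id x).div_const √2)).div_const Real.pi
    refine h.congr_deriv ?_
    have hs : √(2 - x ^ 2) = √2 * √(1 - (x / √2) ^ 2) := by
      rw [← Real.sqrt_mul (by norm_num), div_pow, hsq]
      congr 1
      ring
    rw [hs, one_div_mul_one_div, div_div]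
    congr 1
    ring
  have hpos : ∀ x ∈ Set.Ioo (-√2) √2, 0 ≤ 1 / (Real.pi * √(2 - x ^ 2)) := fun x _ => by positivity
  have hint := intervalIntegral.integrableOn_deriv_of_nonneg hcont hderiv hpos
  have hval := intervalIntegral.integral_eq_sub_of_hasDerivAt_of_le hle hcont hderiv
    ((intervalIntegrable_iff_integrableOn_Ioc_of_le hle).2 hint)
  constructor
  rw [arcsineMeasure, withDensity_apply _ MeasurableSet.univ, Measure.restrict_univ,
    ← ofReal_integral_eq_lintegral_ofReal (hint.mono_set Set.Ioo_subset_Ioc_self)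
      (ae_of_all _ fun x => by positivity),
    ← integral_Ioc_eq_integral_Ioo, ← intervalIntegral.integral_of_le hle, hval,
    neg_div, div_self h2.ne', Real.arcsin_neg, Real.arcsin_one]
  have := Real.pi_ne_zero
  field_simp
  norm_num

/-- The arcsine law with mean `0` and variance `1`, on `[-√2, √2]`. -/
noncomputable def arcsineLaw : ProbabilityMeasure ℝ :=
  ⟨arcsineMeasure, isProbabilityMeasure_arcsineMeasure⟩

end MonotoneCLT

/-!
Write `S` for the sum of the first `N` variables and `y` for the next one. Pulling the peaks `y ^ q`
out of a word, from the left, gives `φ (S ^ j * (S + y) ^ n) = ∑ [z ^ (n - k)] M ^ (k + 1) *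
φ (S ^ (j + k))`, where `M = 1 + z ^ 2 + ⋯` is the moment series of `y`. Hence the increment in `N`
of `φ (S ^ (n + 2))` is `(n + 1) * φ (S ^ n)` plus multiples of lower moments, and by the
Stolz–Cesàro theorem the limits `m` of the normalized moments satisfy
`m (n + 2) = 2 * (n + 1) / (n + 2) * m n`. Integrating the derivative of
`x ^ (n + 1) * √(2 - x ^ 2)` shows that the moments of the arcsine law satisfy the same recursion.
Since the arcsine law has compact support, the Taylor expansion of characteristic functions and
Lévy's theorem turn convergence of moments into weak convergence.

The peak rule concerns words without scalar letters only. It extends to all words because in each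
algebra generated by one variable a scalar is a difference of two elements that are not scalars.
-/

namespace MonotoneCLT

/-! ### Moments of the arcsine law -/

theorem integrable_pow_of_compl_null {μ : Measure ℝ} [IsFiniteMeasure μ] {K : Set ℝ}
    (hK : IsCompact K) (hμ : μ Kᶜ = 0) (n : ℕ) : Integrable (fun x : ℝ => x ^ n) μ := by
  rw [← Measure.restrict_eq_self_of_ae_mem (μ := μ) (s := K) hμ]
  exact (continuous_pow n).continuousOn.integrableOn_compact hK

instance : IsProbabilityMeasure arcsineMeasure := isProbabilityMeasure_arcsineMeasure

theorem arcsineMeasure_compl_Icc : arcsineMeasure (Set.Icc (-√2) √2)ᶜ = 0 := by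
  refine withDensity_absolutelyContinuous _ _ ?_
  rw [Measure.restrict_apply measurableSet_Icc.compl,
    (Set.disjoint_compl_left_iff_subset.2 Set.Ioo_subset_Icc_self).inter_eq, measure_empty]

theorem integrable_pow_arcsineMeasure (n : ℕ) : Integrable (fun x : ℝ => x ^ n) arcsineMeasure :=
  integrable_pow_of_compl_null isCompact_Icc arcsineMeasure_compl_Icc n

theorem integral_arcsineMeasure_of_hasDerivAt {F g : ℝ → ℝ}
    (hF : ContinuousOn F (Set.Icc (-√2) √2))
    (hderiv : ∀ x ∈ Set.Ioo (-√2) √2, HasDerivAt F (g x / √(2 - x ^ 2)) x)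
    (hg : Integrable g arcsineMeasure) :
    ∫ x, g x ∂arcsineMeasure = Real.pi⁻¹ * (F √2 - F (-√2)) := by
  have hle : -√2 ≤ √2 := neg_le_self (Real.sqrt_nonneg 2)
  have hmeas : Measurable fun x : ℝ => ENNReal.ofReal (1 / (Real.pi * √(2 - x ^ 2))) := by fun_prop
  have htop : ∀ᵐ x ∂volume.restrict (Set.Ioo (-√2) √2),
      ENNReal.ofReal (1 / (Real.pi * √(2 - x ^ 2))) < ⊤ :=
    ae_of_all _ fun _ => ENNReal.ofReal_lt_top
  have hdensity : ∀ x : ℝ, (ENNReal.ofReal (1 / (Real.pi * √(2 - x ^ 2)))).toReal • g x =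
      Real.pi⁻¹ * (g x / √(2 - x ^ 2)) := by
    intro x
    rw [ENNReal.toReal_ofReal (by positivity), smul_eq_mul, one_div, mul_inv]
    ring
  rw [arcsineMeasure, integrable_withDensity_iff_integrable_smul' hmeas htop] at hg
  simp only [hdensity, integrable_const_mul_iff (IsUnit.mk0 _ (inv_ne_zero Real.pi_ne_zero))] at hg
  rw [arcsineMeasure, integral_withDensity_eq_integral_toReal_smul hmeas htop]
  simp only [hdensity]
  rw [integral_const_mul, ← integral_Ioc_eq_integral_Ioo, ← intervalIntegral.integral_of_le hle,
    intervalIntegral.integral_eq_sub_of_hasDerivAt_of_le hle hF hderiv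
      ((intervalIntegrable_iff_integrableOn_Ioo_of_le hle).2 hg)]

theorem hasDerivAt_sqrt_two_sub_sq {x : ℝ} (hx : x ∈ Set.Ioo (-√2) √2) :
    HasDerivAt (fun x : ℝ => √(2 - x ^ 2)) (-x / √(2 - x ^ 2)) x := by
  have hpos : 0 < 2 - x ^ 2 := sub_pos.2 (Real.sq_lt.2 hx)
  refine (((hasDerivAt_pow 2 x).const_sub 2).sqrt hpos.ne').congr_deriv ?_
  have := (Real.sqrt_pos.2 hpos).ne'
  field_simp
  push_cast
  ring

theorem integral_id_arcsineMeasure : ∫ x, x ∂arcsineMeasure = 0 := by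
  rw [integral_arcsineMeasure_of_hasDerivAt (F := fun x => -√(2 - x ^ 2)) (by fun_prop)
    (fun x hx => (hasDerivAt_sqrt_two_sub_sq hx).neg.congr_deriv (by rw [neg_div, neg_neg]))
    (by simpa using integrable_pow_arcsineMeasure 1)]
  simp

/-- Integrate the derivative of `x ^ (n + 1) * √(2 - x ^ 2)`. -/
theorem integral_pow_add_two_arcsineMeasure (n : ℕ) :
    ∫ x, x ^ (n + 2) ∂arcsineMeasure = 2 * (n + 1) / (n + 2) * ∫ x, x ^ n ∂arcsineMeasure := by
  have h_int₀ := (integrable_pow_arcsineMeasure n).const_mul (2 * ((n : ℝ) + 1))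
  have h_int₂ := (integrable_pow_arcsineMeasure (n + 2)).const_mul ((n : ℝ) + 2)
  have hderiv : ∀ x ∈ Set.Ioo (-√2) √2, HasDerivAt (fun x => x ^ (n + 1) * √(2 - x ^ 2))
      ((2 * (n + 1) * x ^ n - (n + 2) * x ^ (n + 2)) / √(2 - x ^ 2)) x := by
    intro x hx
    have hpos : 0 < 2 - x ^ 2 := sub_pos.2 (Real.sq_lt.2 hx)
    refine ((hasDerivAt_pow (n + 1) x).mul (hasDerivAt_sqrt_two_sub_sq hx)).congr_deriv ?_
    have := (Real.sqrt_pos.2 hpos).ne'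
    field_simp
    rw [Real.sq_sqrt hpos.le, Nat.add_sub_cancel]
    push_cast
    ring
  have h := integral_arcsineMeasure_of_hasDerivAt (by fun_prop) hderiv (h_int₀.sub h_int₂)
  rw [integral_sub h_int₀ h_int₂, integral_const_mul, integral_const_mul] at h
  simp only [neg_sq, Real.sq_sqrt zero_le_two, sub_self, Real.sqrt_zero, mul_zero] at h
  field_simp
  linarith

theorem doubleFactorial_two_mul_succ_sub_one (n : ℕ) :
    Nat.doubleFactorial (2 * (n + 1) - 1) = (2 * n + 1) * Nat.doubleFactorial (2 * n - 1) :=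
  Nat.doubleFactorial_add_one (2 * n)

theorem integral_pow_even_arcsineMeasure (n : ℕ) :
    ∫ x, x ^ (2 * n) ∂arcsineMeasure =
      (Nat.doubleFactorial (2 * n - 1) : ℝ) / (Nat.factorial n : ℝ) := by
  induction n with
  | zero => simp
  | succ n ih =>
    rw [mul_add_one, integral_pow_add_two_arcsineMeasure, ih, ← mul_add_one,
      doubleFactorial_two_mul_succ_sub_one, Nat.factorial_succ]
    push_cast
    field_simp

theorem integral_pow_odd_arcsineMeasure (n : ℕ) :
    ∫ x, x ^ (2 * n + 1) ∂arcsineMeasure = 0 := by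
  induction n with
  | zero => simpa using integral_id_arcsineMeasure
  | succ n ih =>
    rw [show 2 * (n + 1) + 1 = 2 * n + 1 + 2 by ring, integral_pow_add_two_arcsineMeasure, ih,
      mul_zero]

/-! ### Convergence of moments and weak convergence -/

theorem hasDerivAt_exp_ofReal_mul_I_sub_sum (n : ℕ) (x : ℝ) :
    HasDerivAt (fun x : ℝ => Complex.exp (x * Complex.I) -
        ∑ k ∈ Finset.range (n + 1), (x * Complex.I) ^ k / (k.factorial : ℂ))
      ((Complex.exp (x * Complex.I) -
        ∑ k ∈ Finset.range n, (x * Complex.I) ^ k / (k.factorial : ℂ)) * Complex.I) x := by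
  have hI : HasDerivAt (fun x : ℝ => (x : ℂ) * Complex.I) Complex.I x := by
    simpa using (Complex.ofRealCLM.hasDerivAt (x := x)).mul_const Complex.I
  simp only [Finset.sum_range_succ' _ n, pow_zero]
  have hterm : ∀ k ∈ Finset.range n, HasDerivAt
      (fun x : ℝ => (x * Complex.I) ^ (k + 1) / ((k + 1).factorial : ℂ)) _ x :=
    fun k _ => (hI.fun_pow (k + 1)).div_const _
  refine (hI.cexp.fun_sub ((HasDerivAt.fun_sum hterm).add_const _)).congr_deriv ?_
  rw [sub_mul, Finset.sum_mul]
  congr 1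
  refine Finset.sum_congr rfl fun k _ => ?_
  rw [Nat.factorial_succ, Nat.add_sub_cancel]
  push_cast
  have := k.cast_add_one_ne_zero (R := ℂ)
  field_simp

theorem norm_exp_ofReal_mul_I_sub_sum_le (n : ℕ) (x : ℝ) :
    ‖Complex.exp (x * Complex.I) - ∑ k ∈ Finset.range n, (x * Complex.I) ^ k / (k.factorial : ℂ)‖ ≤
      |x| ^ n / n.factorial := by
  induction n generalizing x with
  | zero => simp [Complex.norm_exp_ofReal_mul_I]
  | succ n ih =>
    set D : ℕ → ℝ → ℂ := fun n x => Complex.exp (x * Complex.I) -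
      ∑ k ∈ Finset.range n, (x * Complex.I) ^ k / (k.factorial : ℂ) with hD
    have hzero : D (n + 1) 0 = 0 := by simp [hD, Finset.sum_range_succ']
    have hcont : Continuous (D n) := by fun_prop
    have hint : ∀ {f : ℝ → ℝ}, Continuous f → IntegrableOn f (Set.uIoc 0 x) := fun hf =>
      (hf.intervalIntegrable 0 x).def'
    have hFTC : ∫ y in 0..x, D n y * Complex.I = D (n + 1) x - D (n + 1) 0 :=
      intervalIntegral.integral_eq_sub_of_hasDerivAt
        (fun y _ => hasDerivAt_exp_ofReal_mul_I_sub_sum n y)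
        ((hcont.mul continuous_const).intervalIntegrable 0 x)
    calc ‖D (n + 1) x‖ = ‖∫ y in 0..x, D n y * Complex.I‖ := by rw [hFTC, hzero, sub_zero]
      _ ≤ ∫ y in Set.uIoc 0 x, ‖D n y * Complex.I‖ :=
          intervalIntegral.norm_integral_le_integral_norm_uIoc
      _ ≤ ∫ y in Set.uIoc 0 x, |y - 0| ^ n / n.factorial := by
          refine integral_mono (hint (by fun_prop)) (hint (by fun_prop)) fun y => ?_
          simpa using ih y
      _ = |x| ^ (n + 1) / (n + 1).factorial := by
          rw [integral_div, integral_pow_abs_sub_uIoc, sub_zero, Nat.factorial_succ, div_div]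
          push_cast
          rfl

theorem norm_charFun_sub_sum_le {μ : Measure ℝ} [IsFiniteMeasure μ]
    (hμ : ∀ n : ℕ, Integrable (fun x : ℝ => x ^ n) μ) (n : ℕ) (t : ℝ) :
    ‖charFun μ t - ∑ k ∈ Finset.range n,
      (t * Complex.I) ^ k / (k.factorial : ℂ) * (∫ x, x ^ k ∂μ : ℝ)‖ ≤
      |t| ^ n / n.factorial * ∫ x, |x| ^ n ∂μ := by
  have hterm : ∀ (k : ℕ) (x : ℝ), ((t * x : ℝ) * Complex.I) ^ k / (k.factorial : ℂ) =
      (t * Complex.I) ^ k / (k.factorial : ℂ) * (x ^ k : ℝ) := by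
    intro k x
    push_cast
    ring
  have hint : ∀ k, Integrable (fun x : ℝ => ((t * x : ℝ) * Complex.I) ^ k / (k.factorial : ℂ)) μ :=
    fun k => by
      simp only [hterm]
      exact (hμ k).ofReal.const_mul _
  have hsum : ∑ k ∈ Finset.range n, (t * Complex.I) ^ k / (k.factorial : ℂ) * (∫ x, x ^ k ∂μ : ℝ) =
      ∫ x, ∑ k ∈ Finset.range n, ((t * x : ℝ) * Complex.I) ^ k / (k.factorial : ℂ) ∂μ := by
    rw [integral_finsetSum _ fun k _ => hint k]
    simp only [hterm, integral_const_mul, integral_complex_ofReal]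
  have hexp : Integrable (fun x : ℝ => Complex.exp ((t * x : ℝ) * Complex.I)) μ :=
    Integrable.of_bound (by fun_prop) 1 (ae_of_all _ fun x => (Complex.norm_exp_ofReal_mul_I _).le)
  have habs : Integrable (fun x : ℝ => |x| ^ n) μ := by simpa using (hμ n).abs
  rw [hsum, charFun_apply_real, ← integral_const_mul]
  simp only [← Complex.ofReal_mul]
  rw [← integral_sub hexp (integrable_finsetSum _ fun k _ => hint k)]
  refine norm_integral_le_of_norm_le (habs.const_mul _) (ae_of_all _ fun x => ?_)
  refine (norm_exp_ofReal_mul_I_sub_sum_le n (t * x)).trans_eq ?_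
  rw [abs_mul, mul_pow, mul_div_right_comm]

theorem tendsto_of_tendsto_moments {μ : ℕ → ProbabilityMeasure ℝ} {ν : ProbabilityMeasure ℝ}
    (hμ : ∀ N n : ℕ, Integrable (fun x : ℝ => x ^ n) (μ N : Measure ℝ))
    (hν : ∀ n : ℕ, Integrable (fun x : ℝ => x ^ n) (ν : Measure ℝ))
    (hdet : ∀ t : ℝ, Tendsto (fun n : ℕ => t ^ n / n.factorial * ∫ x, |x| ^ n ∂(ν : Measure ℝ))
      atTop (𝓝 0))
    (h : ∀ n : ℕ, Tendsto (fun N => ∫ x, x ^ n ∂(μ N : Measure ℝ)) atTop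
      (𝓝 (∫ x, x ^ n ∂(ν : Measure ℝ)))) :
    Tendsto μ atTop (𝓝 ν) := by
  refine ProbabilityMeasure.tendsto_of_tendsto_charFun fun t => ?_
  set T : ℕ → Measure ℝ → ℂ := fun n ρ => ∑ k ∈ Finset.range n,
    (t * Complex.I) ^ k / (k.factorial : ℂ) * (∫ x, x ^ k ∂ρ : ℝ)
  set R : ℕ → Measure ℝ → ℝ := fun n ρ => |t| ^ n / n.factorial * ∫ x, |x| ^ n ∂ρ with hR
  have hTlim : ∀ n, Tendsto (fun N => T n (μ N)) atTop (𝓝 (T n ν)) := fun n =>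
    tendsto_finsetSum _ fun k _ =>
      ((Complex.continuous_ofReal.tendsto _).comp (h k)).const_mul _
  have hRlim : ∀ m, Tendsto (fun N => R (2 * m) (μ N)) atTop (𝓝 (R (2 * m) ν)) := fun m => by
    simpa only [hR, (even_two_mul m).pow_abs] using (h (2 * m)).const_mul _
  have hbound : ∀ n N, dist (charFun (μ N : Measure ℝ) t) (charFun (ν : Measure ℝ) t) ≤
      R n (μ N) + ‖T n (μ N) - T n ν‖ + R n ν := by
    intro n N
    rw [← dist_eq_norm (T n (μ N))]
    refine (dist_triangle4 _ (T n (μ N)) (T n ν) _).trans ?_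
    gcongr
    · exact (dist_eq_norm _ _).trans_le (norm_charFun_sub_sum_le (hμ N) n t)
    · rw [dist_comm]
      exact (dist_eq_norm _ _).trans_le (norm_charFun_sub_sum_le hν n t)
  rw [Metric.tendsto_nhds]
  intro ε hε
  obtain ⟨m, hm⟩ : ∃ m, R (2 * m) ν + ‖T (2 * m) ν - T (2 * m) ν‖ + R (2 * m) ν < ε := by
    have hdet' := (hdet |t|).comp (tendsto_id.const_mul_atTop' (zero_lt_two (α := ℕ)))
    obtain ⟨m, hm⟩ := (hdet'.eventually_lt_const (half_pos hε)).exists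
    refine ⟨m, ?_⟩
    rw [sub_self, norm_zero, add_zero]
    exact (add_lt_add hm hm).trans_eq (add_halves ε)
  have hlim := ((hRlim m).add ((hTlim (2 * m)).sub_const (T (2 * m) ν)).norm).add_const
    (R (2 * m) ν)
  filter_upwards [hlim.eventually_lt_const hm] with N hN
  exact (hbound (2 * m) N).trans_lt hN

theorem tendsto_pow_div_factorial_mul_integral_of_compl_null {μ : Measure ℝ}
    [IsProbabilityMeasure μ] {K : Set ℝ} (hK : IsCompact K) (hμ : μ Kᶜ = 0) (t : ℝ) :
    Tendsto (fun n : ℕ => t ^ n / n.factorial * ∫ x, |x| ^ n ∂μ) atTop (𝓝 0) := by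
  obtain ⟨r, hr⟩ := hK.isBounded.exists_norm_le
  have hle : ∀ n, ‖∫ x, |x| ^ n ∂μ‖ ≤ r ^ n := fun n => by
    have hae : ∀ᵐ x ∂μ, ‖|x| ^ n‖ ≤ r ^ n := by
      filter_upwards [show ∀ᵐ x ∂μ, x ∈ K from hμ] with x hx
      rw [norm_pow, Real.norm_eq_abs, abs_abs]
      exact pow_le_pow_left₀ (abs_nonneg x) (hr x hx) n
    simpa using norm_integral_le_of_norm_le_const hae
  refine squeeze_zero_norm (fun n => ?_)
    (FloorSemiring.tendsto_pow_div_factorial_atTop (|t| * r))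
  rw [norm_mul, norm_div, norm_pow, Real.norm_eq_abs, RCLike.norm_natCast, mul_pow,
    mul_div_right_comm]
  gcongr
  exact hle n

theorem tendsto_of_tendsto_moments_of_compl_null {μ : ℕ → ProbabilityMeasure ℝ}
    {ν : ProbabilityMeasure ℝ}
    (hμ : ∀ N n : ℕ, Integrable (fun x : ℝ => x ^ n) (μ N : Measure ℝ))
    {K : Set ℝ} (hK : IsCompact K) (hν : (ν : Measure ℝ) Kᶜ = 0)
    (h : ∀ n : ℕ, Tendsto (fun N => ∫ x, x ^ n ∂(μ N : Measure ℝ)) atTop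
      (𝓝 (∫ x, x ^ n ∂(ν : Measure ℝ)))) :
    Tendsto μ atTop (𝓝 ν) :=
  tendsto_of_tendsto_moments hμ (integrable_pow_of_compl_null hK hν)
    (tendsto_pow_div_factorial_mul_integral_of_compl_null hK hν) h

theorem eq_of_moments_eq {μ ν : ProbabilityMeasure ℝ} {K : Set ℝ}
    (hμ : ∀ n : ℕ, Integrable (fun x : ℝ => x ^ n) (μ : Measure ℝ))
    (hK : IsCompact K) (hν : (ν : Measure ℝ) Kᶜ = 0)
    (h : ∀ n : ℕ, ∫ x, x ^ n ∂(μ : Measure ℝ) = ∫ x, x ^ n ∂(ν : Measure ℝ)) : μ = ν :=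
  tendsto_nhds_unique (tendsto_const_nhds (f := (atTop : Filter ℕ)))
    (tendsto_of_tendsto_moments_of_compl_null (fun _ => hμ) hK hν fun n => by
      simpa only [h n] using tendsto_const_nhds)

theorem IsDistribution.integrable_pow {A : Type*} [Ring A] [Algebra ℂ A] {φ : A →ₗ[ℂ] ℂ} {a : A}
    {μ : ProbabilityMeasure ℝ} (hμ : IsDistribution φ a μ) (n : ℕ) :
    Integrable (fun x : ℝ => x ^ n) (μ : Measure ℝ) := by
  obtain ⟨K, hK, hμK⟩ := hμ.1
  exact integrable_pow_of_compl_null hK hμK n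

/-! ### Existence and uniqueness of distributions -/

open scoped CompactlySupported in
theorem exists_integral_eq_positiveLinearMap {K : Type*} [TopologicalSpace K] [T2Space K]
    [CompactSpace K] [MeasurableSpace K] [BorelSpace K] (Λ : C(K, ℝ) →ₚ[ℝ] ℝ) :
    ∃ μ : Measure K, IsFiniteMeasure μ ∧ ∀ f : C(K, ℝ), ∫ x, f x ∂μ = Λ f := by
  let Λ' : C_c(K, ℝ) →ₚ[ℝ] ℝ :=
    { toFun f := Λ f
      map_add' f g := map_add Λ (f : C(K, ℝ)) g
      map_smul' c f := map_smul Λ c (f : C(K, ℝ))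
      monotone' _ _ h := Λ.monotone' h }
  exact ⟨RealRMK.rieszMeasure Λ', inferInstance, fun f => RealRMK.integral_rieszMeasure Λ'
    (CompactlySupportedContinuousMap.continuousMapEquiv f)⟩

/-- Polarization: `b` is half of `(1 + b) ^ 2 - 1 ^ 2 - b ^ 2`. -/
theorem IsState.im_eq_zero {A : Type*} [Ring A] [StarRing A] [Algebra ℂ A] {φ : A →ₗ[ℂ] ℂ}
    (hφ : IsState φ) {b : A} (hb : IsSelfAdjoint b) : (φ b).im = 0 := by
  have hsq : ∀ {c : A}, IsSelfAdjoint c → (φ (c * c)).im = 0 := fun {c} hc => by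
    simpa only [hc.star_eq] using (Complex.nonneg_iff.1 (hφ.nonneg c)).2.symm
  have h := hsq ((IsSelfAdjoint.one A).add hb)
  rw [show (1 + b) * (1 + b) = 1 + b + b + b * b by noncomm_ring] at h
  simp only [map_add, Complex.add_im, hφ.map_one, Complex.one_im, hsq hb] at h
  linarith

theorem IsState.exists_measure_integral_eq_cfcHom {A : Type*} [CStarAlgebra A] {φ : A →ₗ[ℂ] ℂ}
    (hφ : IsState φ) {a : A} (ha : IsSelfAdjoint a) :
    ∃ μ : Measure (spectrum ℝ a), IsProbabilityMeasure μ ∧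
      ∀ f : C(spectrum ℝ a, ℝ), φ (cfcHom ha f) = (∫ x, f x ∂μ : ℝ) := by
  have hpos : ∀ f : C(spectrum ℝ a, ℝ), 0 ≤ f → 0 ≤ (φ (cfcHom ha f)).re := by
    intro f hf
    let g : C(spectrum ℝ a, ℝ) := ⟨fun x => √(f x), by fun_prop⟩
    have hg : f = star g * g := by
      ext x
      exact (Real.mul_self_sqrt (hf x)).symm
    rw [hg, map_mul, map_star]
    exact (Complex.nonneg_iff.1 (hφ.nonneg _)).1
  obtain ⟨μ, _, hμ⟩ := exists_integral_eq_positiveLinearMap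
    (PositiveLinearMap.mk₀ (Complex.reLm ∘ₗ φ.restrictScalars ℝ ∘ₗ (cfcHom ha).toLinearMap) hpos)
  have h_int : ∀ f : C(spectrum ℝ a, ℝ), φ (cfcHom ha f) = (∫ x, f x ∂μ : ℝ) := fun f => by
    rw [hμ f]
    exact Complex.ext rfl (hφ.im_eq_zero ((IsSelfAdjoint.all f).map (cfcHom ha)))
  refine ⟨μ, ⟨?_⟩, h_int⟩
  have h_one := h_int 1
  rw [_root_.map_one, hφ.map_one, eq_comm, Complex.ofReal_eq_one] at h_one
  simpa [measureReal_def, ENNReal.toReal_eq_one_iff] using h_one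

theorem IsState.exists_isDistribution {A : Type*} [CStarAlgebra A] {φ : A →ₗ[ℂ] ℂ}
    (hφ : IsState φ) {a : A} (ha : IsSelfAdjoint a) :
    ∃ μ : ProbabilityMeasure ℝ, IsDistribution φ a μ := by
  obtain ⟨μ, _, hμ⟩ := hφ.exists_measure_integral_eq_cfcHom ha
  have hK : IsCompact (spectrum ℝ a) := ContinuousFunctionalCalculus.isCompact_spectrum a
  refine ⟨⟨μ.map Subtype.val, Measure.isProbabilityMeasure_map (by fun_prop)⟩,
    ⟨spectrum ℝ a, hK, ?_⟩, fun n => ?_⟩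
  · rw [ProbabilityMeasure.coe_mk, Measure.map_apply (by fun_prop) hK.measurableSet.compl]
    simp
  · rw [ProbabilityMeasure.coe_mk, integral_map (by fun_prop) (by fun_prop)]
    simpa [cfcHom_id] using hμ ((ContinuousMap.id ℝ).restrict (spectrum ℝ a) ^ n)

theorem IsState.existsUnique_isDistribution {A : Type*} [CStarAlgebra A] {φ : A →ₗ[ℂ] ℂ}
    (hφ : IsState φ) {a : A} (ha : IsSelfAdjoint a) :
    ∃! μ : ProbabilityMeasure ℝ, IsDistribution φ a μ := by
  obtain ⟨μ, hμ⟩ := hφ.exists_isDistribution ha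
  refine ⟨μ, hμ, fun ν hν => ?_⟩
  obtain ⟨K, hK, hμK⟩ := hμ.1
  exact eq_of_moments_eq hν.integrable_pow hK hμK fun n =>
    Complex.ofReal_injective ((hν.2 n).symm.trans (hμ.2 n))

theorem isSelfAdjoint_normalizedSum {A : Type*} [Ring A] [StarRing A] [Algebra ℂ A]
    [StarModule ℂ A] {X : ℕ → A} (hsa : ∀ i, IsSelfAdjoint (X i)) (N : ℕ) :
    IsSelfAdjoint (normalizedSum X N) := by
  refine IsSelfAdjoint.smul ?_ (isSelfAdjoint_sum _ fun i _ => hsa i)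
  rw [← Complex.ofReal_inv]
  exact Complex.conj_ofReal _

/-! ### The peak rule for words with scalar letters -/

theorem le_span_sdiff {R M : Type*} [Ring R] [AddCommGroup M] [Module R M] {S T : Submodule R M}
    (h : ¬ S ≤ T) : S ≤ Submodule.span R (S \ T) := by
  obtain ⟨x, hxS, hxT⟩ := SetLike.not_le_iff_exists.1 h
  intro b hb
  by_cases hbT : b ∈ T
  · rw [← add_sub_cancel_right b x]
    have hbx : b + x ∉ T := fun h => hxT ((T.add_mem_iff_right hbT).1 h)
    exact sub_mem (Submodule.subset_span ⟨add_mem hb hxS, hbx⟩) (Submodule.subset_span ⟨hxS, hxT⟩)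
  · exact Submodule.subset_span ⟨hb, hbT⟩

section ReducedWords

variable {A Λ : Type*} [Ring A] [StarRing A] [Algebra ℂ A]
  {𝒜 : Λ → NonUnitalStarSubalgebra ℂ A}

/-- The words to which the peak rule of monotone independence applies: the letters are not scalars
and neighbouring letters have different indices. -/
structure IsReducedWord (𝒜 : Λ → NonUnitalStarSubalgebra ℂ A) (w : List (Λ × A)) : Prop where
  letters : ∀ q ∈ w, q.2 ∈ 𝒜 q.1 ∧ ∀ c : ℂ, q.2 ≠ algebraMap ℂ A c
  chain : w.IsChain fun q r => q.1 ≠ r.1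

/-- The linear span of the products of reduced words with all indices in `I` and, unless the word is
empty, the first index in `J`. -/
def reducedSpan (𝒜 : Λ → NonUnitalStarSubalgebra ℂ A) (I J : Set Λ) : Submodule ℂ A :=
  .span ℂ {a | ∃ w, IsReducedWord 𝒜 w ∧ (∀ q ∈ w, q.1 ∈ I) ∧ (∀ q ∈ w.head?, q.1 ∈ J) ∧
    (w.map Prod.snd).prod = a}

theorem reducedSpan_mono_right (I : Set Λ) {J K : Set Λ} (h : J ⊆ K) :
    reducedSpan 𝒜 I J ≤ reducedSpan 𝒜 I K :=
  Submodule.span_mono fun _ ⟨w, hw, hI, hJ, ha⟩ => ⟨w, hw, hI, fun q hq => h (hJ q hq), ha⟩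

theorem one_mem_reducedSpan (I J : Set Λ) : 1 ∈ reducedSpan 𝒜 I J :=
  Submodule.subset_span ⟨[], ⟨by simp, .nil⟩, by simp, by simp, by simp⟩

theorem mem_span_nonscalar {i : Λ} (hi : ∃ a ∈ 𝒜 i, ∀ c : ℂ, a ≠ algebraMap ℂ A c) {b : A}
    (hb : b ∈ 𝒜 i) :
    b ∈ Submodule.span ℂ {a | a ∈ 𝒜 i ∧ ∀ c : ℂ, a ≠ algebraMap ℂ A c} := by
  have hle : ¬ (𝒜 i).toNonUnitalSubalgebra.toSubmodule ≤ 1 := fun h => by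
    obtain ⟨a, ha, hac⟩ := hi
    obtain ⟨c, hc⟩ := Submodule.mem_one.1 (h ha)
    exact hac c hc.symm
  refine Submodule.span_mono ?_ (le_span_sdiff hle hb)
  exact fun a ⟨ha, ha'⟩ => ⟨ha, fun c hc => ha' (Submodule.mem_one.2 ⟨c, hc.symm⟩)⟩

theorem IsReducedWord.cons {w : List (Λ × A)} (hw : IsReducedWord 𝒜 w) {i : Λ} {a : A}
    (ha : a ∈ 𝒜 i) (hac : ∀ c : ℂ, a ≠ algebraMap ℂ A c) (hhead : ∀ q ∈ w.head?, i ≠ q.1) :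
    IsReducedWord 𝒜 ((i, a) :: w) :=
  ⟨List.forall_mem_cons.2 ⟨⟨ha, hac⟩, hw.letters⟩, List.isChain_cons.2 ⟨hhead, hw.chain⟩⟩

theorem IsReducedWord.mul_prod_mem_reducedSpan {w : List (Λ × A)} (hw : IsReducedWord 𝒜 w)
    {I : Set Λ} (hI : ∀ q ∈ w, q.1 ∈ I) {i : Λ} (hi : i ∈ I) (hhead : ∀ q ∈ w.head?, i ≠ q.1)
    (hns : ∃ a ∈ 𝒜 i, ∀ c : ℂ, a ≠ algebraMap ℂ A c) {b : A} (hb : b ∈ 𝒜 i) :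
    b * (w.map Prod.snd).prod ∈ reducedSpan 𝒜 I {i} := by
  suffices h : Submodule.span ℂ {a | a ∈ 𝒜 i ∧ ∀ c : ℂ, a ≠ algebraMap ℂ A c} ≤
      (reducedSpan 𝒜 I {i}).comap (LinearMap.mulRight ℂ (w.map Prod.snd).prod) from
    h (mem_span_nonscalar hns hb)
  refine Submodule.span_le.2 fun a ⟨ha, hac⟩ => Submodule.subset_span ?_
  exact ⟨(i, a) :: w, hw.cons ha hac hhead, List.forall_mem_cons.2 ⟨hi, hI⟩, by simp, by simp⟩

theorem mul_mem_reducedSpan {I : Set Λ} {i : Λ} (hi : i ∈ I)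
    (hns : ∃ a ∈ 𝒜 i, ∀ c : ℂ, a ≠ algebraMap ℂ A c) {b c : A} (hb : b ∈ 𝒜 i)
    (hc : c ∈ reducedSpan 𝒜 I Set.univ) : b * c ∈ reducedSpan 𝒜 I {i} := by
  suffices h : reducedSpan 𝒜 I Set.univ ≤ (reducedSpan 𝒜 I {i}).comap (LinearMap.mulLeft ℂ b) from
    h hc
  refine Submodule.span_le.2 ?_
  rintro _ ⟨w, hw, hI, -, rfl⟩
  change b * (w.map Prod.snd).prod ∈ reducedSpan 𝒜 I {i}
  rcases w with _ | ⟨⟨j, a⟩, w⟩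
  · exact hw.mul_prod_mem_reducedSpan hI hi (by simp) hns hb
  obtain ⟨hhead, hchain⟩ := List.isChain_cons.1 hw.chain
  obtain ⟨⟨ha, -⟩, hletters⟩ := List.forall_mem_cons.1 hw.letters
  by_cases hij : i = j
  · subst hij
    rw [List.map_cons, List.prod_cons, ← mul_assoc]
    exact IsReducedWord.mul_prod_mem_reducedSpan ⟨hletters, hchain⟩
      (List.forall_mem_cons.1 hI).2 hi hhead hns (mul_mem hb ha)
  · exact hw.mul_prod_mem_reducedSpan hI hi (by simpa using hij) hns hb

theorem adjoin_le_reducedSpan {x : Λ → A} (hx : ∀ i, x i ∈ 𝒜 i)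
    (hns : ∀ i (c : ℂ), x i ≠ algebraMap ℂ A c) (I : Set Λ) :
    (Algebra.adjoin ℂ (x '' I)).toSubmodule ≤ reducedSpan 𝒜 I Set.univ := by
  rw [Algebra.adjoin_eq_span, Submodule.span_le]
  intro a ha
  induction ha using Submonoid.closure_induction_left with
  | one => exact one_mem_reducedSpan I Set.univ
  | mul_left _ hb c _ hc =>
    obtain ⟨i, hi, rfl⟩ := hb
    exact reducedSpan_mono_right I (Set.subset_univ _)
      (mul_mem_reducedSpan hi ⟨x i, hx i, hns i⟩ (hx i) hc)

theorem MonotoneIndependentSubalgebras.map_prod_mul_mul_prod [LinearOrder Λ] {φ : A →ₗ[ℂ] ℂ}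
    (hind : MonotoneIndependentSubalgebras φ 𝒜) {k : Λ}
    (hns : ∃ a ∈ 𝒜 k, ∀ c : ℂ, a ≠ algebraMap ℂ A c) {u v : List (Λ × A)}
    (hu : IsReducedWord 𝒜 u) (hv : IsReducedWord 𝒜 v) (huk : ∀ q ∈ u, q.1 < k)
    (hvk : ∀ q ∈ v.head?, q.1 < k) {b : A} (hb : b ∈ 𝒜 k) :
    φ ((u.map Prod.snd).prod * (b * (v.map Prod.snd).prod)) =
      φ b * φ ((u.map Prod.snd).prod * (v.map Prod.snd).prod) := by
  have hlast : ∀ q ∈ u.getLast?, q.1 < k := fun q hq => huk q (List.mem_of_getLast? hq)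
  have h := LinearMap.eqOn_span (f := φ ∘ₗ LinearMap.mulLeft ℂ (u.map Prod.snd).prod ∘ₗ
      LinearMap.mulRight ℂ (v.map Prod.snd).prod)
    (g := φ ((u.map Prod.snd).prod * (v.map Prod.snd).prod) • φ) ?_ (mem_span_nonscalar hns hb)
  · simpa [mul_comm] using h
  rintro a ⟨ha, hac⟩
  have hkv := hv.cons ha hac fun q hq => (hvk q hq).ne'
  have h := hind u v (k, a) (List.forall_mem_append.2 ⟨hu.letters, hkv.letters⟩)
    (hu.chain.append hkv.chain fun q hq r hr => by
      obtain rfl : (k, a) = r := by simpa using hr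
      exact (hlast q hq).ne) hlast hvk
  simpa [mul_comm] using h

theorem MonotoneIndependentSubalgebras.map_mul_mul [LinearOrder Λ] {φ : A →ₗ[ℂ] ℂ}
    (hind : MonotoneIndependentSubalgebras φ 𝒜) {k : Λ}
    (hns : ∃ a ∈ 𝒜 k, ∀ c : ℂ, a ≠ algebraMap ℂ A c) {a b c : A}
    (ha : a ∈ reducedSpan 𝒜 (Set.Iio k) Set.univ) (hb : b ∈ 𝒜 k)
    (hc : c ∈ reducedSpan 𝒜 Set.univ (Set.Iio k)) :
    φ (a * (b * c)) = φ b * φ (a * c) := by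
  induction ha, hc using Submodule.span_induction₂ with
  | mem_mem a c ha hc =>
    obtain ⟨u, hu, huk, -, rfl⟩ := ha
    obtain ⟨v, hv, -, hvk, rfl⟩ := hc
    exact hind.map_prod_mul_mul_prod hns hu hv huk hvk hb
  | zero_left | zero_right => simp
  | add_left _ _ _ _ _ _ hx hy | add_right _ _ _ _ _ _ hx hy =>
    simp only [add_mul, mul_add, map_add, hx, hy]
  | smul_left _ _ _ _ _ h | smul_right _ _ _ _ _ h =>
    simp only [smul_mul_assoc, mul_smul_comm, map_smul, h, smul_eq_mul, mul_left_comm]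

end ReducedWords

/-! ### Moments of a sum of two monotone independent elements -/

section MonotonePair

variable {R A : Type*} [CommRing R] [Ring A] [Algebra R A] {φ : A →ₗ[R] R} {x y : A}

/-- What monotone independence of `x` and `y`, with `y` above `x`, says about words in which the
powers of `y` occur next to powers of `x`. -/
structure IsMonotonePair (φ : A →ₗ[R] R) (x y : A) : Prop where
  map_pow_mul_pow : ∀ j q, φ (x ^ j * y ^ q) = φ (y ^ q) * φ (x ^ j)
  map_pow_mul_pow_mul : ∀ j q, ∀ b ∈ Algebra.adjoin R {x, y},
    φ (x ^ j * (y ^ q * (x * b))) = φ (y ^ q) * φ (x ^ j * (x * b))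

/-- The generating series of the moments of `y`. -/
def momentSeries (φ : A →ₗ[R] R) (y : A) : PowerSeries R :=
  .mk fun n => φ (y ^ n)

open Finset in
theorem add_pow_succ_eq_sum_antidiagonal {S : Type*} [Semiring S] (x y : S) (n : ℕ) :
    (x + y) ^ (n + 1) =
      ∑ p ∈ antidiagonal n, y ^ p.1 * (x * (x + y) ^ p.2) + y ^ (n + 1) := by
  induction n with
  | zero => simp
  | succ n ih =>
    rw [pow_succ', add_mul, Nat.sum_antidiagonal_succ, pow_zero, one_mul, add_assoc]
    congr 1
    rw [ih, mul_add, mul_sum, ← pow_succ' y]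
    simp only [pow_succ' y, mul_assoc]

open Finset in
theorem sum_antidiagonal_sum_antidiagonal_comm {ι M : Type*} [AddCommMonoid ι] [HasAntidiagonal ι]
    [AddCommMonoid M] (f : ι → ι → ι → M) (n : ι) :
    ∑ p ∈ antidiagonal n, ∑ r ∈ antidiagonal p.2, f p.1 r.1 r.2 =
      ∑ p ∈ antidiagonal n, ∑ r ∈ antidiagonal p.2, f r.1 p.1 r.2 := by
  rw [sum_sigma', sum_sigma']
  refine sum_nbij' (fun p => ⟨(p.2.1, p.1.1 + p.2.2), (p.1.1, p.2.2)⟩)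
    (fun p => ⟨(p.2.1, p.1.1 + p.2.2), (p.1.1, p.2.2)⟩) ?_ ?_ ?_ ?_ ?_
  all_goals
    rintro ⟨⟨a, b⟩, ⟨c, d⟩⟩ h
    simp only [mem_sigma, HasAntidiagonal.mem_antidiagonal] at h
    obtain ⟨rfl, rfl⟩ := h
  · simp [add_left_comm]
  · simp [add_left_comm]
  all_goals rfl

open Finset in
theorem IsMonotonePair.map_pow_mul_add_pow (h : IsMonotonePair φ x y) (j n : ℕ) :
    φ (x ^ j * (x + y) ^ n) =
      ∑ p ∈ antidiagonal n, (momentSeries φ y ^ (p.1 + 1)).coeff p.2 * φ (x ^ (j + p.1)) := by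
  induction n using Nat.strong_induction_on generalizing j with
  | _ n ih =>
  rcases n with _ | n
  · simpa [momentSeries] using h.map_pow_mul_pow j 0
  have hmem : ∀ r, (x + y) ^ r ∈ Algebra.adjoin R {x, y} := fun r =>
    pow_mem (add_mem (Algebra.subset_adjoin (by simp)) (Algebra.subset_adjoin (by simp))) r
  calc φ (x ^ j * (x + y) ^ (n + 1))
      = ∑ p ∈ antidiagonal n, φ (y ^ p.1) * φ (x ^ (j + 1) * (x + y) ^ p.2) +
          φ (y ^ (n + 1)) * φ (x ^ j) := by
        rw [add_pow_succ_eq_sum_antidiagonal, mul_add, mul_sum, map_add, map_sum,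
          h.map_pow_mul_pow]
        simp only [h.map_pow_mul_pow_mul j _ _ (hmem _), pow_succ, mul_assoc]
    _ = ∑ p ∈ antidiagonal n, ∑ r ∈ antidiagonal p.2, φ (y ^ p.1) *
          ((momentSeries φ y ^ (r.1 + 1)).coeff r.2 * φ (x ^ (j + 1 + r.1))) +
          φ (y ^ (n + 1)) * φ (x ^ j) := by
        congr 1
        refine sum_congr rfl fun p hp => ?_
        have hp' : p.2 < n + 1 := by
          rw [HasAntidiagonal.mem_antidiagonal] at hp
          omega
        rw [ih p.2 hp', mul_sum]
    _ = ∑ p ∈ antidiagonal n, (momentSeries φ y ^ (p.1 + 2)).coeff p.2 * φ (x ^ (j + 1 + p.1)) +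
          φ (y ^ (n + 1)) * φ (x ^ j) := by
        rw [sum_antidiagonal_sum_antidiagonal_comm fun q k l => φ (y ^ q) *
          ((momentSeries φ y ^ (k + 1)).coeff l * φ (x ^ (j + 1 + k)))]
        congr 1
        refine sum_congr rfl fun p _ => ?_
        rw [pow_succ' _ (p.1 + 1), PowerSeries.coeff_mul, sum_mul]
        simp only [momentSeries, PowerSeries.coeff_mk, mul_assoc]
    _ = _ := by
        rw [Nat.sum_antidiagonal_succ, add_comm]
        simp [momentSeries, add_assoc, add_comm 1]

theorem coeff_two_pow {M : PowerSeries R} (h0 : M.constantCoeff = 1) (h1 : M.coeff 1 = 0) (n : ℕ) :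
    (M ^ n).coeff 2 = n * M.coeff 2 := by
  induction n with
  | zero => simp
  | succ n ih =>
    rw [pow_succ, PowerSeries.coeff_mul, Finset.Nat.sum_antidiagonal_eq_sum_range_succ_mk]
    simp only [Finset.sum_range_succ, Finset.sum_range_zero, Nat.sub_zero, Nat.reduceSub, ih, h1,
      PowerSeries.coeff_zero_eq_constantCoeff_apply, map_pow, h0]
    push_cast
    ring

open Finset in
theorem IsMonotonePair.map_add_pow_add_two (h : IsMonotonePair φ x y) (h1 : φ 1 = 1)
    (hy : φ y = 0) (n : ℕ) :
    φ ((x + y) ^ (n + 2)) = φ (x ^ (n + 2)) + ∑ p ∈ antidiagonal n,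
      (momentSeries φ y ^ (p.1 + 1)).coeff (p.2 + 2) * φ (x ^ p.1) := by
  have h_sum := h.map_pow_mul_add_pow 0 (n + 2)
  rw [Nat.sum_antidiagonal_succ', Nat.sum_antidiagonal_succ'] at h_sum
  simpa [momentSeries, h1, hy, PowerSeries.coeff_one_pow, add_assoc] using h_sum

end MonotonePair

section LinearOrder

variable {A Λ : Type*} [Ring A] [StarRing A] [Algebra ℂ A] [LinearOrder Λ]
  {𝒜 : Λ → NonUnitalStarSubalgebra ℂ A} {x : Λ → A} {s : Finset Λ} {k : Λ}

theorem sum_mul_mem_reducedSpan (hx : ∀ i, x i ∈ 𝒜 i) (hns : ∀ i (c : ℂ), x i ≠ algebraMap ℂ A c)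
    (hs : ∀ i ∈ s, i < k) {b : A} (hb : b ∈ Algebra.adjoin ℂ (x '' Set.univ)) :
    (∑ i ∈ s, x i) * b ∈ reducedSpan 𝒜 Set.univ (Set.Iio k) := by
  rw [Finset.sum_mul]
  refine sum_mem fun i hi => ?_
  have hik : {i} ⊆ Set.Iio k := Set.singleton_subset_iff.2 (hs i hi)
  exact reducedSpan_mono_right Set.univ hik (mul_mem_reducedSpan (Set.mem_univ i)
    ⟨x i, hx i, hns i⟩ (hx i) (adjoin_le_reducedSpan hx hns Set.univ hb))

theorem MonotoneIndependentSubalgebras.isMonotonePair {φ : A →ₗ[ℂ] ℂ} (h1 : φ 1 = 1)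
    (hind : MonotoneIndependentSubalgebras φ 𝒜) (hx : ∀ i, x i ∈ 𝒜 i)
    (hns : ∀ i (c : ℂ), x i ≠ algebraMap ℂ A c) (hs : ∀ i ∈ s, i < k) :
    IsMonotonePair φ (∑ i ∈ s, x i) (x k) := by
  have hpow : ∀ q, x k ^ (q + 1) ∈ 𝒜 k := fun q => by
    induction q with
    | zero => simpa using hx k
    | succ q ih => exact pow_succ (x k) (q + 1) ▸ mul_mem ih (hx k)
  have hsum : ∀ {I : Set Λ}, (∀ i ∈ s, i ∈ I) → ∑ i ∈ s, x i ∈ Algebra.adjoin ℂ (x '' I) :=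
    fun hI => sum_mem fun i hi => Algebra.subset_adjoin ⟨i, hI i hi, rfl⟩
  have hpull : ∀ j q, ∀ c ∈ reducedSpan 𝒜 Set.univ (Set.Iio k),
      φ ((∑ i ∈ s, x i) ^ j * (x k ^ q * c)) = φ (x k ^ q) * φ ((∑ i ∈ s, x i) ^ j * c) := by
    rintro j (_ | q) c hc
    · simp [h1]
    · exact hind.map_mul_mul ⟨x k, hx k, hns k⟩
        (adjoin_le_reducedSpan hx hns _ (pow_mem (hsum hs) j)) (hpow q) hc
  refine ⟨fun j q => ?_, fun j q b hb => hpull j q _ (sum_mul_mem_reducedSpan hx hns hs ?_)⟩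
  · simpa using hpull j q 1 (one_mem_reducedSpan _ _)
  · refine Algebra.adjoin_le ?_ hb
    rintro _ (rfl | rfl)
    · exact hsum fun i _ => Set.mem_univ i
    · exact Algebra.subset_adjoin ⟨k, Set.mem_univ k, rfl⟩

end LinearOrder

theorem ne_algebraMap_of_map_sq_ne {R A : Type*} [CommRing R] [Ring A] [Algebra R A]
    {φ : A →ₗ[R] R} (h1 : φ 1 = 1) {a : A} (ha : φ (a ^ 2) ≠ φ a ^ 2) (c : R) :
    a ≠ algebraMap R A c := by
  rintro rfl
  simp [Algebra.algebraMap_eq_smul_one, smul_pow, h1] at ha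

open Finset in
theorem MonotoneIndependent.map_sum_range_succ_pow {A : Type*} [Ring A] [StarRing A] [Algebra ℂ A]
    [StarModule ℂ A] {φ : A →ₗ[ℂ] ℂ} {X : ℕ → A} (h1 : φ 1 = 1) (hind : MonotoneIndependent φ X)
    (hid : IdenticallyDistributed φ X) (hmean : φ (X 0) = 0) (hvar : φ (X 0 ^ 2) ≠ 0) (N n : ℕ) :
    φ ((∑ i ∈ range (N + 1), X i) ^ (n + 2)) = φ ((∑ i ∈ range N, X i) ^ (n + 2)) +
      ∑ p ∈ antidiagonal n, (momentSeries φ (X 0) ^ (p.1 + 1)).coeff (p.2 + 2) *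
        φ ((∑ i ∈ range N, X i) ^ p.1) := by
  have hmean' : ∀ i, φ (X i) = 0 := fun i => by simpa [hmean] using hid i 0 1
  have hX : ∀ i (c : ℂ), X i ≠ algebraMap ℂ A c := fun i =>
    ne_algebraMap_of_map_sq_ne h1 (by simpa [hmean', hid i 0 2] using hvar)
  have hseries : momentSeries φ (X N) = momentSeries φ (X 0) :=
    PowerSeries.ext fun q => by simpa [momentSeries] using hid N 0 q
  have hpair : IsMonotonePair φ (∑ i ∈ range N, X i) (X N) :=
    MonotoneIndependentSubalgebras.isMonotonePair h1 hind
      (fun i => NonUnitalStarAlgebra.self_mem_adjoin_singleton ℂ (X i)) hX fun i => mem_range.1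
  rw [sum_range_succ, ← hseries]
  exact hpair.map_add_pow_add_two h1 (hmean' N) n

/-! ### Growth of the moments -/

open Asymptotics in
theorem isLittleO_of_isLittleO_succ_sub {E : Type*} [NormedAddCommGroup E] {f : ℕ → E} {g : ℕ → ℝ}
    (hg : Monotone g) (hg_top : Tendsto g atTop atTop)
    (h : (fun N => f (N + 1) - f N) =o[atTop] fun N => g (N + 1) - g N) : f =o[atTop] g := by
  have h_norm : Tendsto (fun N => ‖g N‖) atTop atTop := tendsto_norm_atTop_atTop.comp hg_top
  have h_sum : (fun N => f N - f 0) =o[atTop] fun N => g N - g 0 := by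
    have h_top : Tendsto (fun N => g N - g 0) atTop atTop :=
      tendsto_atTop_add_const_right _ _ hg_top
    simpa only [Finset.sum_range_sub] using h.sum_range (fun N => sub_nonneg.2 (hg N.le_succ))
      (by simpa only [Finset.sum_range_sub] using h_top)
  have h_g : (fun N => g N - g 0) =O[atTop] g :=
    (isBigO_refl g _).sub (isLittleO_const_left.2 (.inr h_norm)).isBigO
  exact ((h_sum.trans_isBigO h_g).add (isLittleO_const_left (c := f 0).2 (.inr h_norm))).congr_left
    fun N => sub_add_cancel _ _

open Asymptotics in
theorem tendsto_inv_smul_of_tendsto_inv_sub_smul_sub {E : Type*} [NormedAddCommGroup E]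
    [NormedSpace ℝ E] {b : ℕ → E} {g : ℕ → ℝ} {L : E} (hg : StrictMono g)
    (hg_top : Tendsto g atTop atTop)
    (h : Tendsto (fun N => (g (N + 1) - g N)⁻¹ • (b (N + 1) - b N)) atTop (𝓝 L)) :
    Tendsto (fun N => (g N)⁻¹ • b N) atTop (𝓝 L) := by
  have h_one : (fun N => (g (N + 1) - g N)⁻¹ • (b (N + 1) - b N) - L) =o[atTop]
      fun _ => (1 : ℝ) := (isLittleO_one_iff ℝ).2 (tendsto_sub_nhds_zero_iff.2 h)
  have h_sub : (fun N => b N - g N • L) =o[atTop] g := by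
    refine isLittleO_of_isLittleO_succ_sub hg.monotone hg_top ?_
    refine ((isBigO_refl (fun N => g (N + 1) - g N) atTop).smul_isLittleO h_one).congr
      (fun N => ?_) fun N => ?_
    · rw [smul_sub, smul_inv_smul₀ (sub_pos.2 (hg N.lt_succ_self)).ne', sub_smul]
      abel
    · rw [smul_eq_mul, mul_one]
  have h_inv : (fun N => (g N)⁻¹ • g N) =O[atTop] fun _ => (1 : ℝ) := by
    refine EventuallyEq.isBigO ?_
    filter_upwards [hg_top.eventually_gt_atTop 0] with N hN
    rw [smul_eq_mul, inv_mul_cancel₀ hN.ne']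
  have h_lim := (isLittleO_one_iff ℝ).1
    (((isBigO_refl (fun N => (g N)⁻¹) atTop).smul_isLittleO h_sub).trans_isBigO h_inv)
  refine tendsto_sub_nhds_zero_iff.1 (h_lim.congr' ?_)
  filter_upwards [hg_top.eventually_gt_atTop 0] with N hN
  rw [smul_sub, inv_smul_smul₀ hN.ne']

theorem strictMono_sqrt_natCast_pow (n : ℕ) : StrictMono fun N : ℕ => √(N : ℝ) ^ (n + 1) :=
  fun _ _ h => pow_lt_pow_left₀ (Real.sqrt_lt_sqrt (by positivity) (by exact_mod_cast h))
    (by positivity) (by simp)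

theorem tendsto_sqrt_natCast_atTop : Tendsto (fun N : ℕ => √(N : ℝ)) atTop atTop :=
  Real.tendsto_sqrt_atTop.comp tendsto_natCast_atTop_atTop

theorem tendsto_sqrt_succ_pow_sub_div (n : ℕ) :
    Tendsto (fun N : ℕ => (√((N + 1 : ℕ) : ℝ) ^ (n + 2) - √(N : ℝ) ^ (n + 2)) / √(N : ℝ) ^ n) atTop
      (𝓝 ((n + 2) / 2)) := by
  have hderiv : HasDerivAt (fun t : ℝ => √(1 + t) ^ (n + 2)) ((n + 2) / 2) 0 := by
    have h := (((hasDerivAt_id (0 : ℝ)).const_add 1).sqrt (by simp)).pow (n + 2)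
    refine h.congr_deriv ?_
    simp
    ring
  have hinv : Tendsto (fun N : ℕ => (N : ℝ)⁻¹) atTop (𝓝[≠] 0) :=
    ((tendsto_inv_atTop_nhdsGT_zero (𝕜 := ℝ)).mono_right (nhdsGT_le_nhdsNE 0)).comp
      tendsto_natCast_atTop_atTop
  refine (hderiv.tendsto_slope_zero.comp hinv).congr' ?_
  filter_upwards [eventually_gt_atTop 0] with N hN
  have hN' : (0 : ℝ) < N := Nat.cast_pos.2 hN
  have hs : √((N + 1 : ℕ) : ℝ) = √(N : ℝ) * √(1 + (N : ℝ)⁻¹) := by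
    rw [← Real.sqrt_mul hN'.le, mul_add, mul_inv_cancel₀ hN'.ne', Nat.cast_succ, mul_one]
  have hsq : √(N : ℝ) ^ (n + 2) = √(N : ℝ) ^ n * N := by
    rw [pow_add, Real.sq_sqrt hN'.le]
  rw [hs, mul_pow, hsq]
  simp only [Function.comp_apply, inv_inv, smul_eq_mul, zero_add, add_zero, Real.sqrt_one, one_pow]
  field_simp

theorem tendsto_inv_sqrt_pow_smul_of_sub {E : Type*} [NormedAddCommGroup E] [NormedSpace ℝ E]
    {b : ℕ → E} {n : ℕ} {L : E}
    (h : Tendsto (fun N : ℕ => (√(N : ℝ) ^ n)⁻¹ • (b (N + 1) - b N)) atTop (𝓝 L)) :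
    Tendsto (fun N : ℕ => (√(N : ℝ) ^ (n + 2))⁻¹ • b N) atTop (𝓝 ((2 / (n + 2) : ℝ) • L)) := by
  refine tendsto_inv_smul_of_tendsto_inv_sub_smul_sub (strictMono_sqrt_natCast_pow (n + 1))
    ((tendsto_pow_atTop (by simp)).comp tendsto_sqrt_natCast_atTop) ?_
  have h' := ((tendsto_sqrt_succ_pow_sub_div n).inv₀ (by positivity)).smul h
  rw [inv_div] at h'
  refine h'.congr' ?_
  filter_upwards [eventually_gt_atTop 0] with N hN
  have : (√(N : ℝ) ^ n) ≠ 0 := by positivity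
  rw [smul_smul, inv_div, div_mul_eq_mul_div, mul_inv_cancel₀ this, one_div]

open Finset in
theorem tendsto_inv_sqrt_pow_smul_of_recurrence {a c : ℕ → ℕ → ℂ} {m : ℕ → ℂ}
    (ha0 : ∀ N, a N 0 = m 0) (ha1 : ∀ N, a N 1 = m 1)
    (ha : ∀ N n, a (N + 1) (n + 2) = a N (n + 2) + ∑ p ∈ antidiagonal n, c p.1 p.2 * a N p.1)
    (hm1 : m 1 = 0) (hm : ∀ n, m (n + 2) = 2 / (n + 2) * (c n 0 * m n)) (n : ℕ) :
    Tendsto (fun N : ℕ => (√(N : ℝ) ^ n)⁻¹ • a N n) atTop (𝓝 (m n)) := by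
  have h_inv : Tendsto (fun N : ℕ => (√(N : ℝ))⁻¹) atTop (𝓝 0) :=
    tendsto_inv_atTop_zero.comp tendsto_sqrt_natCast_atTop
  induction n using Nat.strong_induction_on with
  | _ n ih =>
  rcases n with _ | _ | n
  · simp [ha0]
  · simp [ha1, hm1]
  have h_term : ∀ p ∈ antidiagonal n, Tendsto
      (fun N : ℕ => ((√(N : ℝ))⁻¹ ^ p.2) • (c p.1 p.2 * ((√(N : ℝ) ^ p.1)⁻¹ • a N p.1))) atTop
      (𝓝 ((0 : ℝ) ^ p.2 • (c p.1 p.2 * m p.1))) := fun p hp => by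
    rw [HasAntidiagonal.mem_antidiagonal] at hp
    exact (h_inv.pow p.2).smul ((ih p.1 (by omega)).const_mul _)
  have h_limit : ∑ p ∈ antidiagonal n, (0 : ℝ) ^ p.2 • (c p.1 p.2 * m p.1) = c n 0 * m n := by
    rw [sum_eq_single (n, 0)]
    · simp
    · rintro ⟨k, l⟩ hkl hne
      rw [HasAntidiagonal.mem_antidiagonal] at hkl
      have hl : l ≠ 0 := by
        rintro rfl
        exact hne (by simpa using hkl)
      simp [hl]
    · simp
  have h := tendsto_inv_sqrt_pow_smul_of_sub (b := fun N => a N (n + 2)) (n := n)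
    (L := c n 0 * m n) ?_
  · rw [hm n]
    convert h using 2
    simp
  rw [← h_limit]
  refine (tendsto_finsetSum _ h_term).congr fun N => ?_
  rw [ha, add_sub_cancel_left, smul_sum]
  refine sum_congr rfl fun p hp => ?_
  rw [HasAntidiagonal.mem_antidiagonal] at hp
  rw [mul_smul_comm, smul_smul, ← hp, pow_add, mul_inv, inv_pow, mul_comm (_ ^ p.2)⁻¹]

theorem MonotoneIndependent.tendsto_map_normalizedSum_pow {A : Type*} [Ring A] [StarRing A]
    [Algebra ℂ A] [StarModule ℂ A] {φ : A →ₗ[ℂ] ℂ} {X : ℕ → A} (hind : MonotoneIndependent φ X)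
    (h1 : φ 1 = 1) (hid : IdenticallyDistributed φ X) (hmean : φ (X 0) = 0)
    (hvar : φ (X 0 ^ 2) = 1) (n : ℕ) :
    Tendsto (fun N => φ (normalizedSum X N ^ n)) atTop
      (𝓝 ((∫ x, x ^ n ∂arcsineMeasure : ℝ) : ℂ)) := by
  have h := tendsto_inv_sqrt_pow_smul_of_recurrence
    (a := fun N n => φ ((∑ i ∈ Finset.range N, X i) ^ n))
    (c := fun k l => (momentSeries φ (X 0) ^ (k + 1)).coeff (l + 2))
    (m := fun n => ((∫ x, x ^ n ∂arcsineMeasure : ℝ) : ℂ))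
    (by simp [h1]) (fun N => ?_)
    (hind.map_sum_range_succ_pow h1 hid hmean (hvar ▸ one_ne_zero))
    (by simp [integral_id_arcsineMeasure]) (fun n => ?_) n
  · refine h.congr fun N => ?_
    rw [normalizedSum, smul_pow, map_smul, smul_eq_mul, Complex.real_smul]
    simp
  · have hmean' : ∀ i, φ (X i) = 0 := fun i => by simpa [hmean] using hid i 0 1
    simp [hmean', integral_id_arcsineMeasure]
  · have hcoeff : (momentSeries φ (X 0) ^ (n + 1)).coeff 2 = n + 1 := by
      rw [coeff_two_pow (by simp [momentSeries, h1]) (by simp [momentSeries, hmean])]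
      simp [momentSeries, hvar]
    simp only [zero_add, hcoeff, integral_pow_add_two_arcsineMeasure]
    push_cast
    ring

end MonotoneCLT

theorem mainTheorem4 {A : Type*} [CStarAlgebra A] (φ : A →ₗ[ℂ] ℂ) (hφ : MonotoneCLT.IsState φ)
    (X : ℕ → A) (hsa : ∀ i, IsSelfAdjoint (X i))
    (hid : MonotoneCLT.IdenticallyDistributed φ X)
    (hind : MonotoneCLT.MonotoneIndependent φ X)
    (hmean : φ (X 0) = 0) (hvar : φ (X 0 ^ 2) = 1) :
    (∀ N : ℕ, ∃! μ : ProbabilityMeasure ℝ,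
      MonotoneCLT.IsDistribution φ (MonotoneCLT.normalizedSum X N) μ) ∧
    (∀ μ : ℕ → ProbabilityMeasure ℝ,
      (∀ N, MonotoneCLT.IsDistribution φ (MonotoneCLT.normalizedSum X N) (μ N)) →
      Tendsto μ atTop (𝓝 MonotoneCLT.arcsineLaw)) ∧
    (∀ n : ℕ, Integrable (fun x : ℝ => x ^ n) (MonotoneCLT.arcsineLaw : Measure ℝ)) ∧
    (∀ n : ℕ, ∫ x, x ^ (2 * n) ∂(MonotoneCLT.arcsineLaw : Measure ℝ) =
      (Nat.doubleFactorial (2 * n - 1) : ℝ) / (Nat.factorial n : ℝ)) ∧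
    (∀ n : ℕ, ∫ x, x ^ (2 * n + 1) ∂(MonotoneCLT.arcsineLaw : Measure ℝ) = 0) := by
  refine ⟨fun N => hφ.existsUnique_isDistribution (MonotoneCLT.isSelfAdjoint_normalizedSum hsa N),
    fun μ hμ => ?_, MonotoneCLT.integrable_pow_arcsineMeasure,
    MonotoneCLT.integral_pow_even_arcsineMeasure, MonotoneCLT.integral_pow_odd_arcsineMeasure⟩
  refine MonotoneCLT.tendsto_of_tendsto_moments_of_compl_null (fun N => (hμ N).integrable_pow)
    isCompact_Icc MonotoneCLT.arcsineMeasure_compl_Icc fun n => ?_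
  have h := hind.tendsto_map_normalizedSum_pow hφ.map_one hid hmean hvar n
  simp_rw [fun N => (hμ N).2 n] at h
  exact (Complex.continuous_re.tendsto _).comp h
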